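/- Let $(M,g)$ be a smooth finite-dimensional Riemannian manifold (without boundary), let $X$ be a vector field on $M$, and let $V\to M$ be a smooth real vector bundle of finite rank with a smooth fibre metric, also denoted $g$, and a smooth connection $\nabla$ compatible with it (for example, any tensor bundle over $M$ with the metric and the Riemannian connection induced by $g$). For a smooth section $T$ of $\mathrm{End}(V)$ let $\nabla T$ be its covariant derivative for the induced connection, $(\nabla_Y T)(s)=\nabla_Y(T(s))-T(\nabla_Y s)$, and let $$\Delta_X T=\sum_i \nabla^2_{E_i,E_i}T-\nabla_X T,\qquad \nabla^2_{Y,Z}T=\nabla_Y(\nabla_Z T)-\nabla_{\nabla_Y Z}T,$$ where $(E_i)$ is an orthonormal basis of the tangent space and $\nabla_Y Z$ is the Levi-Civita connection of $(M,g)$. Suppose that $T$ is symmetric ($g(T(s),t)=g(s,T(t))$ for all $s,t\in V_x$), nonnegative ($g(T(s),s)\ge 0$ for all $s\in V_x$), and of constant rank, and that $$g\big((\Delta_X T)(s),s\big)\le 0\qquad\text{for all } x\in M \text{ and all } s\in\ker T_x\subseteq V_x .$$ Then $\ker T$ is a parallel subbundle of $V$: the spaces $\ker T_x$ form a smooth vector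 subbundle of $V$, and for every smooth section $s$ of $\ker T$ over an open subset of $M$ and every tangent vector $u$ at a point of that subset, $\nabla_u s\in\ker T$. -/

import Mathlib

open Bundle Manifold
open scoped ContDiff Topology

noncomputable section HomConnection

variable
  {E : Type*} [NormedAddCommGroup E] [NormedSpace ℝ E] [FiniteDimensional ℝ E]
  {H : Type*} [TopologicalSpace H] {I : ModelWithCorners ℝ E H}
  {M : Type*} [TopologicalSpace M] [ChartedSpace H M] [IsManifold I 2 M]
  {F : Type*} [NormedAddCommGroup F] [NormedSpace ℝ F] [FiniteDimensional ℝ F]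
  {V : M → Type*} [TopologicalSpace (TotalSpace F V)]
  [∀ x, AddCommGroup (V x)] [∀ x, Module ℝ (V x)] [∀ x, TopologicalSpace (V x)]
  [∀ x, IsTopologicalAddGroup (V x)] [∀ x, ContinuousSMul ℝ (V x)]
  [FiberBundle F V] [VectorBundle ℝ F V] [ContMDiffVectorBundle 1 F V I]
  {F' : Type*} [NormedAddCommGroup F'] [NormedSpace ℝ F'] [FiniteDimensional ℝ F']
  {W : M → Type*} [TopologicalSpace (TotalSpace F' W)]
  [∀ x, AddCommGroup (W x)] [∀ x, Module ℝ (W x)] [∀ x, TopologicalSpace (W x)]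
  [∀ x, IsTopologicalAddGroup (W x)] [∀ x, ContinuousSMul ℝ (W x)]
  [FiberBundle F' W] [VectorBundle ℝ F' W] [ContMDiffVectorBundle 1 F' W I]

/-- The expression `∇_Y (A σ) - A (∇_Y σ)` at the point `x`. -/
def homCovAux (covV : CovariantDerivative I F V) (covW : CovariantDerivative I F' W)
    (A : Π x : M, V x →L[ℝ] W x) (x : M)
    (Y : Π x : M, TangentSpace I x) (σ : Π x : M, V x) : W x :=
  covW (fun y ↦ A y (σ y)) x (Y x) - A x (covV σ x (Y x))

theorem homCovAux_tensorial_left (covV : CovariantDerivative I F V)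
    (covW : CovariantDerivative I F' W) (A : Π x : M, V x →L[ℝ] W x) (x : M)
    (σ : Π x : M, V x) :
    TensorialAt I E (homCovAux covV covW A x · σ) x where
  smul _ _ := by simp [homCovAux, smul_sub]
  add _ _ := by simp only [homCovAux, Pi.add_apply, map_add]; abel

theorem homCovAux_tensorial_right (covV : CovariantDerivative I F V)
    (covW : CovariantDerivative I F' W) {A : Π x : M, V x →L[ℝ] W x} {x : M}
    (hA : MDifferentiableAt I (I.prod 𝓘(ℝ, F →L[ℝ] F'))
      (fun y ↦ TotalSpace.mk' (F →L[ℝ] F') (E := fun y ↦ V y →L[ℝ] W y) y (A y)) x)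
    (Y : Π x : M, TangentSpace I x) :
    TensorialAt I F (homCovAux covV covW A x Y) x where
  smul {f σ} hf hσ := by
    have h : (fun y ↦ A y ((f • σ) y)) = f • (fun y ↦ A y (σ y)) := by
      ext y; simp
    simp only [homCovAux, h]
    rw [covV.isCovariantDerivativeOnUniv.leibniz hσ hf,
      covW.isCovariantDerivativeOnUniv.leibniz (hA.clm_bundle_apply hσ) hf]
    simp [smul_sub]
  add {σ σ'} hσ hσ' := by
    have h : (fun y ↦ A y ((σ + σ') y)) = (fun y ↦ A y (σ y)) + (fun y ↦ A y (σ' y)) := by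
      ext y; simp
    simp only [homCovAux, h]
    rw [covV.isCovariantDerivativeOnUniv.add hσ hσ',
      covW.isCovariantDerivativeOnUniv.add (hA.clm_bundle_apply hσ) (hA.clm_bundle_apply hσ')]
    simp only [add_apply, map_add]
    abel

open scoped Classical in
/-- The underlying map of the induced connection on `Hom(V, W)`, characterized at a section `A`
differentiable at `x` by `(∇_Y A) σ = ∇_Y (A σ) - A (∇_Y σ)` (see `homCov_apply`); its value
where `A` is not differentiable is irrelevant and set to zero. -/
def homCov (covV : CovariantDerivative I F V) (covW : CovariantDerivative I F' W)
    (A : Π x : M, V x →L[ℝ] W x) (x : M) : TangentSpace I x →L[ℝ] (V x →L[ℝ] W x) :=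
  if hA : MDifferentiableAt I (I.prod 𝓘(ℝ, F →L[ℝ] F'))
      (fun y ↦ TotalSpace.mk' (F →L[ℝ] F') (E := fun y ↦ V y →L[ℝ] W y) y (A y)) x then
    TensorialAt.mkHom₂ (I := I) (F := E) (F' := F) (V := fun x : M ↦ TangentSpace I x)
      (homCovAux covV covW A x) x
      (fun σ _ ↦ homCovAux_tensorial_left covV covW A x σ)
      (fun Y _ ↦ homCovAux_tensorial_right covV covW hA Y)
  else 0

theorem homCov_apply (covV : CovariantDerivative I F V) (covW : CovariantDerivative I F' W)
    {A : Π x : M, V x →L[ℝ] W x} {x : M}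
    (hA : MDifferentiableAt I (I.prod 𝓘(ℝ, F →L[ℝ] F'))
      (fun y ↦ TotalSpace.mk' (F →L[ℝ] F') (E := fun y ↦ V y →L[ℝ] W y) y (A y)) x)
    {σ : Π x : M, V x}
    (hσ : MDifferentiableAt I (I.prod 𝓘(ℝ, F)) (fun y ↦ TotalSpace.mk' F y (σ y)) x)
    (u : TangentSpace I x) :
    homCov covV covW A x u (σ x) = covW (fun y ↦ A y (σ y)) x u - A x (covV σ x u) := by
  rw [homCov, dif_pos hA, TensorialAt.mkHom₂_apply_eq_extend]
  rw [(homCovAux_tensorial_right covV covW hA _).pointwise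
    (FiberBundle.mdifferentiableAt_extend ..) hσ (by simp)]
  simp [homCovAux]

/-- The connection on the bundle `Hom(V, W)` induced by connections on `V` and `W`. -/
def CovariantDerivative.hom (covV : CovariantDerivative I F V)
    (covW : CovariantDerivative I F' W) :
    CovariantDerivative I (F →L[ℝ] F') (fun x : M ↦ V x →L[ℝ] W x) where
  toFun := homCov covV covW
  isCovariantDerivativeOnUniv :=
    { add := by
        intro A B x hA hB _
        have hAB := mdifferentiableAt_add_section hA hB
        ext u v
        have hσ := FiberBundle.mdifferentiableAt_extend I F v
        have h := homCov_apply covV covW hAB hσ u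
        have hA' := homCov_apply covV covW hA hσ u
        have hB' := homCov_apply covV covW hB hσ u
        have e : (fun y ↦ (A + B) y (FiberBundle.extend F v y))
            = (fun y ↦ A y (FiberBundle.extend F v y))
              + (fun y ↦ B y (FiberBundle.extend F v y)) := by
          ext y; simp
        have hadd := covW.isCovariantDerivativeOnUniv.add
          (hA.clm_bundle_apply hσ) (hB.clm_bundle_apply hσ) (Set.mem_univ x)
        have hadd' : covW (fun y ↦ (A + B) y (FiberBundle.extend F v y)) x u = _ :=
          (congrArg (fun φ ↦ φ x u) (congrArg covW.toFun e)).trans (congrArg (· u) hadd)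
        simp only [FiberBundle.extend_apply_self] at h hA' hB'
        refine h.trans ?_
        rw [hadd']
        simp only [add_apply, Pi.add_apply, hA', hB']
        abel
      leibniz := by
        intro A g x hA hg _
        have hgA := hg.smul_section hA
        ext u v
        have hσ := FiberBundle.mdifferentiableAt_extend I F v
        have h := homCov_apply covV covW hgA hσ u
        have hA' := homCov_apply covV covW hA hσ u
        have e : (fun y ↦ (g • A) y (FiberBundle.extend F v y))
            = g • (fun y ↦ A y (FiberBundle.extend F v y)) := by
          ext y; simp
        have hlei := covW.isCovariantDerivativeOnUniv.leibniz
          (hA.clm_bundle_apply hσ) hg (Set.mem_univ x)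
        have hlei' : covW (fun y ↦ (g • A) y (FiberBundle.extend F v y)) x u = _ :=
          (congrArg (fun φ ↦ φ x u) (congrArg covW.toFun e)).trans (congrArg (· u) hlei)
        simp only [FiberBundle.extend_apply_self] at h hA'
        refine h.trans ?_
        rw [hlei']
        simp [hA', smul_sub]
        abel }

end HomConnection

section LeviCivita

variable
  {E : Type*} [NormedAddCommGroup E] [NormedSpace ℝ E] [FiniteDimensional ℝ E]
  {H : Type*} [TopologicalSpace H] {I : ModelWithCorners ℝ E H}
  {M : Type*} [TopologicalSpace M] [ChartedSpace H M] [IsManifold I ∞ M]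
  [RiemannianBundle (fun x : M ↦ TangentSpace I x)]
  [IsContMDiffRiemannianBundle I ∞ E (fun x : M ↦ TangentSpace I x)]

/-- The Levi-Civita (Riemannian) connection of a Riemannian manifold: the connection on the
tangent bundle that is compatible with the metric and torsion-free. -/
structure IsLeviCivita (covM : CovariantDerivative I E (fun x : M ↦ TangentSpace I x)) : Prop where
  metric : CovariantDerivative.IsMetricCompatible (V := fun x : M ↦ TangentSpace I x) covM
  torsion_free : covM.torsion = 0

end LeviCivita

noncomputable section Laplacian

variable
  {E : Type*} [NormedAddCommGroup E] [NormedSpace ℝ E] [FiniteDimensional ℝ E]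
  {H : Type*} [TopologicalSpace H] {I : ModelWithCorners ℝ E H}
  {M : Type*} [TopologicalSpace M] [ChartedSpace H M] [IsManifold I 2 M]
  [RiemannianBundle (fun x : M ↦ TangentSpace I x)]
  {F : Type*} [NormedAddCommGroup F] [NormedSpace ℝ F] [FiniteDimensional ℝ F]
  {W : M → Type*} [TopologicalSpace (TotalSpace F W)]
  [∀ x, AddCommGroup (W x)] [∀ x, Module ℝ (W x)] [∀ x, TopologicalSpace (W x)]
  [∀ x, IsTopologicalAddGroup (W x)] [∀ x, ContinuousSMul ℝ (W x)]
  [FiberBundle F W] [VectorBundle ℝ F W] [ContMDiffVectorBundle 1 F W I]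

/-- The second covariant derivative `∇²_{u,w} τ = ∇_u (∇_w τ) - ∇_{∇_u w} τ` of a section `τ`
of a bundle `W` with connection `covW`, where `covM` is the connection used on the tangent
bundle: the covariant derivative of the section `∇ τ` of `Hom(TM, W)`. -/
def secondCovDeriv (covM : CovariantDerivative I E (fun x : M ↦ TangentSpace I x))
    (covW : CovariantDerivative I F W) (τ : Π x : M, W x) (x : M) :
    TangentSpace I x →L[ℝ] TangentSpace I x →L[ℝ] W x :=
  (covM.hom covW) (covW τ) x

instance finiteDimensional_tangentSpace (x : M) : FiniteDimensional ℝ (TangentSpace I x) :=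
  inferInstanceAs (FiniteDimensional ℝ E)

/-- The connection Laplacian `Δ τ = ∑ᵢ ∇²_{eᵢ,eᵢ} τ`, where `(eᵢ)` is an orthonormal basis
of the tangent space. -/
def connLaplacian (covM : CovariantDerivative I E (fun x : M ↦ TangentSpace I x))
    (covW : CovariantDerivative I F W) (τ : Π x : M, W x) (x : M) : W x :=
  ∑ i, secondCovDeriv covM covW τ x (stdOrthonormalBasis ℝ (TangentSpace I x) i)
    (stdOrthonormalBasis ℝ (TangentSpace I x) i)

/-- The connection Laplacian does not depend on the orthonormal basis. -/
theorem connLaplacian_eq_sum (covM : CovariantDerivative I E (fun x : M ↦ TangentSpace I x))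
    (covW : CovariantDerivative I F W) (τ : Π x : M, W x) (x : M)
    {ι : Type*} [Fintype ι] (b : OrthonormalBasis ι ℝ (TangentSpace I x)) :
    connLaplacian covM covW τ x = ∑ i, secondCovDeriv covM covW τ x (b i) (b i) := by
  classical
  have key : ∀ B : TangentSpace I x →ₗ[ℝ] TangentSpace I x →ₗ[ℝ] W x,
      ∀ {κ : Type} [Fintype κ] (e : OrthonormalBasis κ ℝ (TangentSpace I x)),
        ∑ j, B (e j) (e j) = ∑ i, B (b i) (b i) := by
    intro B κ _ e
    classical
    have expand : ∀ i, B (b i) (b i) =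
        ∑ j, ∑ k, (inner ℝ (e j) (b i) * inner ℝ (b i) (e k)) • B (e j) (e k) := by
      intro i
      conv_lhs => rw [← e.sum_repr' (b i)]
      simp only [map_sum, map_smul, LinearMap.sum_apply, LinearMap.smul_apply,
        Finset.smul_sum, smul_smul]
      rw [Finset.sum_comm]
      simp only [real_inner_comm (b i), mul_comm]
    simp_rw [expand]
    rw [Finset.sum_comm]
    refine Finset.sum_congr rfl fun j _ ↦ ?_
    rw [Finset.sum_comm]
    simp_rw [← Finset.sum_smul, b.sum_inner_mul_inner, e.inner_eq_ite]
    simp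
  let B : TangentSpace I x →ₗ[ℝ] TangentSpace I x →ₗ[ℝ] W x :=
    (ContinuousLinearMap.coeLM ℝ).comp (secondCovDeriv covM covW τ x).toLinearMap
  exact key B (stdOrthonormalBasis ℝ (TangentSpace I x))

/-- The `X`-Laplacian `Δ_X τ = Δ τ - ∇_X τ`. -/
def XLaplacian (covM : CovariantDerivative I E (fun x : M ↦ TangentSpace I x))
    (covW : CovariantDerivative I F W) (X : Π x : M, TangentSpace I x) (τ : Π x : M, W x)
    (x : M) : W x :=
  connLaplacian covM covW τ x - covW τ x (X x)

end Laplacian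

section Subbundle

variable
  {E : Type*} [NormedAddCommGroup E] [NormedSpace ℝ E]
  {H : Type*} [TopologicalSpace H] (I : ModelWithCorners ℝ E H)
  {M : Type*} [TopologicalSpace M] [ChartedSpace H M]
  (F : Type*) [NormedAddCommGroup F] [NormedSpace ℝ F]
  {V : M → Type*} [TopologicalSpace (TotalSpace F V)]
  [∀ x, AddCommGroup (V x)] [∀ x, Module ℝ (V x)] [∀ x, TopologicalSpace (V x)]
  [∀ x, IsTopologicalAddGroup (V x)] [∀ x, ContinuousSMul ℝ (V x)]
  [FiberBundle F V]

/-- A family of subspaces `S x ⊆ V x` is a smooth subbundle (of some rank `r`) if near every point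
there are `r` smooth local sections of `V` whose values form a basis of `S y` for all nearby `y`. -/
def IsSmoothSubbundle (S : Π x : M, Submodule ℝ (V x)) : Prop :=
  ∃ r : ℕ, ∀ x : M, ∃ U : Set M, IsOpen U ∧ x ∈ U ∧ ∃ σ : Fin r → Π y : M, V y,
    (∀ i, ContMDiffOn I (I.prod 𝓘(ℝ, F)) ∞ (fun y ↦ TotalSpace.mk' F y (σ i y)) U) ∧
    ∀ y ∈ U, LinearIndependent ℝ (fun i ↦ σ i y) ∧
      Submodule.span ℝ (Set.range fun i ↦ σ i y) = S y

variable {I F}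

/-- A family of subspaces `S x ⊆ V x` is parallel for a connection `∇` on `V` if `∇_u σ` lies in
`S` for every smooth local section `σ` of `V` with values in `S` and every tangent vector `u`. -/
def IsParallelSubspace (cov : CovariantDerivative I F V) (S : Π x : M, Submodule ℝ (V x)) :
    Prop :=
  ∀ (U : Set M) (σ : Π x : M, V x), IsOpen U →
    ContMDiffOn I (I.prod 𝓘(ℝ, F)) ∞ (fun y ↦ TotalSpace.mk' F y (σ y)) U →
    (∀ y ∈ U, σ y ∈ S y) → ∀ x ∈ U, ∀ u : TangentSpace I x, cov σ x u ∈ S x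

end Subbundle

/-!
Let `σ` be a local section of `ker T`. Differentiating `T σ = 0` twice, pairing with `σ` and using
the symmetry of `T` gives `⟪(Δ_X T) σ, σ⟫ = 2 ∑ᵢ ⟪T (∇_{eᵢ} σ), ∇_{eᵢ} σ⟫`. Every summand is
nonnegative and the left-hand side is nonpositive, so every summand vanishes; by Cauchy–Schwarz for
the nonnegative form `⟪T ·, ·⟫` this means `T (∇_{eᵢ} σ) = 0`.

The kernels form a smooth subbundle because the rank is constant: in a trivialization around `x` let
`A y` be the matrix of `T y` and `C` a generalized inverse of `A x`, i.e. `A x ∘ C ∘ A x = A x`.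
Then `B y = C ∘ A y + (1 - C ∘ A x)` is smooth in `y`, equals `1` at `x`, and maps `ker (A y)` into
`ker (A x)`; by the equality of dimensions it restricts to an isomorphism of kernels for `y` near
`x`. The inverse of `B y` thus carries a basis of `ker (A x)` to a smooth frame.
-/

section HomSections

variable
  {E : Type*} [NormedAddCommGroup E] [NormedSpace ℝ E]
  {H : Type*} [TopologicalSpace H] {I : ModelWithCorners ℝ E H}
  {M : Type*} [TopologicalSpace M] [ChartedSpace H M]
  {F : Type*} [NormedAddCommGroup F] [NormedSpace ℝ F] [FiniteDimensional ℝ F]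
  {k : ℕ∞ω}

theorem contMDiffAt_clm_of_apply {G : Type*} [NormedAddCommGroup G] [NormedSpace ℝ G]
    {Φ : M → F →L[ℝ] G} {x : M} (h : ∀ v, CMDiffAt k (fun y ↦ Φ y v) x) : CMDiffAt k Φ x := by
  let e : (F →L[ℝ] G) ≃L[ℝ] (Fin (Module.finrank ℝ F) → G) :=
    ((ContinuousLinearEquiv.ofFinrankEq (Module.finrank_fin_fun ℝ).symm).arrowCongr
      (.refl ℝ G)).trans (.piRing _)
  have he : ContMDiffAt I 𝓘(ℝ, Fin (Module.finrank ℝ F) → G) k (fun y ↦ e (Φ y)) x :=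
    contMDiffAt_pi_space.2 fun i ↦ h _
  simpa [Function.comp_def] using! e.symm.contDiff.contMDiff.contMDiffAt.comp x he

variable
  {V : M → Type*} [TopologicalSpace (TotalSpace F V)]
  [∀ x, AddCommGroup (V x)] [∀ x, Module ℝ (V x)] [∀ x, TopologicalSpace (V x)]
  [FiberBundle F V] [VectorBundle ℝ F V]
  {F' : Type*} [NormedAddCommGroup F'] [NormedSpace ℝ F']
  {W : M → Type*} [TopologicalSpace (TotalSpace F' W)]
  [∀ x, AddCommGroup (W x)] [∀ x, Module ℝ (W x)] [∀ x, TopologicalSpace (W x)]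
  [∀ x, IsTopologicalAddGroup (W x)] [∀ x, ContinuousSMul ℝ (W x)]
  [FiberBundle F' W] [VectorBundle ℝ F' W]

theorem contMDiffAt_hom_bundle_of_apply_extend {A : Π x : M, V x →L[ℝ] W x} {x : M}
    (h : ∀ v : V x, CMDiffAt k (T% (fun y ↦ A y (FiberBundle.extend F v y))) x) :
    CMDiffAt k
      (fun y ↦ TotalSpace.mk' (F →L[ℝ] F') (E := fun y ↦ V y →L[ℝ] W y) y (A y)) x := by
  refine (contMDiffAt_hom_bundle _).2 ⟨contMDiffAt_id, contMDiffAt_clm_of_apply fun v ↦ ?_⟩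
  have hV := FiberBundle.mem_baseSet_trivializationAt' (F := F) (E := V) x
  have hW := FiberBundle.mem_baseSet_trivializationAt' (F := F') (E := W) x
  have hv := (contMDiffAt_section _).1 (h ((trivializationAt F V x).symm x v))
  refine hv.congr_of_eventuallyEq ?_
  filter_upwards [(trivializationAt F V x).open_baseSet.mem_nhds hV,
    (trivializationAt F' W x).open_baseSet.mem_nhds hW] with y hyV hyW
  simp [ContinuousLinearMap.inCoordinates, FiberBundle.extend, hV, hyV, hyW,
    Bundle.Trivialization.symmL_apply, Bundle.Trivialization.coe_linearMapAt_of_mem]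

end HomSections

section Regularity

variable
  {E : Type*} [NormedAddCommGroup E] [NormedSpace ℝ E] [FiniteDimensional ℝ E]
  {H : Type*} [TopologicalSpace H] {I : ModelWithCorners ℝ E H}
  {M : Type*} [TopologicalSpace M] [T2Space M] [ChartedSpace H M] [IsManifold I ∞ M]
  {F : Type*} [NormedAddCommGroup F] [NormedSpace ℝ F]
  {V : M → Type*} [TopologicalSpace (TotalSpace F V)]
  [∀ x, AddCommGroup (V x)] [∀ x, Module ℝ (V x)] [∀ x, TopologicalSpace (V x)]
  [∀ x, IsTopologicalAddGroup (V x)] [∀ x, ContinuousSMul ℝ (V x)]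
  [FiberBundle F V] [VectorBundle ℝ F V] [ContMDiffVectorBundle ∞ F V I]
  {k : ℕ∞}

theorem contMDiffOn_covariantDerivative (cov : CovariantDerivative I F V)
    [cov.ContMDiffCovariantDerivative k] {σ : Π x : M, V x} {U : Set M} (hU : IsOpen U)
    (hσ : CMDiff[U] (k + 1) (T% σ)) :
    CMDiff[U] k (fun y ↦ TotalSpace.mk' (E →L[ℝ] F)
      (E := fun y ↦ TangentSpace I y →L[ℝ] V y) y (cov σ y)) := by
  intro x hx
  have hk : (k + 1 : ℕ∞ω) ≤ ∞ := by exact_mod_cast le_top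
  have : ContMDiffVectorBundle (k + 1) F V I := .of_le hk
  -- The regularity of `cov` concerns global sections, so cut `σ` off by a bump function equal to
  -- `1` near `x`; by locality this does not change `cov σ` there.
  obtain ⟨f, -, hfU⟩ :=
    (SmoothBumpFunction.nhds_basis_tsupport (I := I) x).mem_iff.1 (hU.mem_nhds hx)
  have hfσ : CMDiff (k + 1) (T% ((f : M → ℝ) • σ)) :=
    (f.contMDiff.of_le hk).contMDiffOn.smul_section_of_tsupport hU hfU hσ
  have hcov := ‹cov.ContMDiffCovariantDerivative k›.contMDiff.contMDiff hfσ.contMDiffOn x trivial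
  refine (hcov.contMDiffAt Filter.univ_mem).congr_of_eventuallyEq ?_ |>.contMDiffWithinAt
  filter_upwards [f.eventuallyEq_one.eventuallyEq_nhds, hU.mem_nhds hx] with y hfy hy
  congr 1
  refine cov.isCovariantDerivativeOnUniv.congr_of_eventuallyEq
    ((hσ.contMDiffAt (hU.mem_nhds hy)).mdifferentiableAt (by simp))
    ((hfσ y).mdifferentiableAt (by simp)) Filter.univ_mem ?_
  filter_upwards [hfy] with z hz
  simp [hz]

variable
  [FiniteDimensional ℝ F]
  {F' : Type*} [NormedAddCommGroup F'] [NormedSpace ℝ F'] [FiniteDimensional ℝ F']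
  {W : M → Type*} [TopologicalSpace (TotalSpace F' W)]
  [∀ x, AddCommGroup (W x)] [∀ x, Module ℝ (W x)] [∀ x, TopologicalSpace (W x)]
  [∀ x, IsTopologicalAddGroup (W x)] [∀ x, ContinuousSMul ℝ (W x)]
  [FiberBundle F' W] [VectorBundle ℝ F' W] [ContMDiffVectorBundle ∞ F' W I]

instance contMDiffCovariantDerivative_hom (covV : CovariantDerivative I F V)
    [covV.ContMDiffCovariantDerivative k] (covW : CovariantDerivative I F' W)
    [covW.ContMDiffCovariantDerivative k] :
    (covV.hom covW).ContMDiffCovariantDerivative k where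
  contMDiff.contMDiff {A} hA x _ := by
    have hk : (k + 1 : ℕ∞ω) ≤ ∞ := by exact_mod_cast le_top
    have : ContMDiffVectorBundle (k + 1) F V I := .of_le hk
    refine (contMDiffAt_hom_bundle_of_apply_extend fun u ↦
      contMDiffAt_hom_bundle_of_apply_extend fun v ↦ ?_).contMDiffWithinAt
    obtain ⟨s, hs, hσs⟩ := FiberBundle.exists_contMDiffOn_extend (k := k + 1) I F v
    let σ := FiberBundle.extend F v
    let Y := FiberBundle.extend E u
    have hx : x ∈ interior s := mem_interior_iff_mem_nhds.2 hs
    have hσ : CMDiff[interior s] (k + 1) (T% σ) := hσs.mono interior_subset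
    have hA : CMDiff (k + 1) (fun y ↦ TotalSpace.mk' (F →L[ℝ] F')
      (E := fun y ↦ V y →L[ℝ] W y) y (A y)) := contMDiffOn_univ.1 hA
    have hY : CMDiffAt k (T% Y) x := FiberBundle.contMDiffAt_extend I E u
    have hcovV := (contMDiffOn_covariantDerivative covV isOpen_interior hσ).contMDiffAt
      (isOpen_interior.mem_nhds hx)
    have hcovW := (contMDiffOn_covariantDerivative covW isOpen_interior
      (hA.contMDiffOn.clm_bundle_apply hσ)).contMDiffAt (isOpen_interior.mem_nhds hx)
    refine ((hcovW.clm_bundle_apply hY).sub_section (((hA x).of_le le_self_add).clm_bundle_apply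
      (hcovV.clm_bundle_apply hY))).congr_of_eventuallyEq ?_
    filter_upwards [isOpen_interior.mem_nhds hx] with y hy
    congr 1
    exact homCov_apply covV covW ((hA y).mdifferentiableAt (by simp))
      ((hσ.contMDiffAt (isOpen_interior.mem_nhds hy)).mdifferentiableAt (by simp)) (Y y)

end Regularity

section Leibniz

variable
  {E : Type*} [NormedAddCommGroup E] [NormedSpace ℝ E]
  {H : Type*} [TopologicalSpace H] {I : ModelWithCorners ℝ E H}
  {M : Type*} [TopologicalSpace M] [ChartedSpace H M]
  {F : Type*} [NormedAddCommGroup F] [NormedSpace ℝ F]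
  {V : M → Type*} [TopologicalSpace (TotalSpace F V)]
  [∀ x, AddCommGroup (V x)] [∀ x, Module ℝ (V x)] [∀ x, TopologicalSpace (V x)]
  [FiberBundle F V] [VectorBundle ℝ F V]

theorem mdifferentiableAt_section_of_eventually_eq_zero {σ : Π x : M, V x} {x : M}
    (hσ : ∀ᶠ y in 𝓝 x, σ y = 0) : MDiffAt (T% σ) x := by
  refine (mdifferentiable_zeroSection ℝ V).mdifferentiableAt.congr_of_eventuallyEq ?_
  filter_upwards [hσ] with y hy
  simp [zeroSection, hy]

variable [∀ x, IsTopologicalAddGroup (V x)] [∀ x, ContinuousSMul ℝ (V x)]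

theorem covariantDerivative_eq_zero_of_eventually_eq_zero (cov : CovariantDerivative I F V)
    {σ : Π x : M, V x} {x : M} (hσ : ∀ᶠ y in 𝓝 x, σ y = 0) : cov σ x = 0 := by
  rw [cov.isCovariantDerivativeOnUniv.congr_of_eventuallyEq
    (mdifferentiableAt_section_of_eventually_eq_zero hσ)
    (mdifferentiableAt_section_of_eventually_eq_zero (σ := 0) (.of_forall fun _ ↦ rfl))
    Filter.univ_mem hσ]
  simp

variable
  [FiniteDimensional ℝ E] [IsManifold I 2 M] [FiniteDimensional ℝ F] [ContMDiffVectorBundle 1 F V I]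

theorem secondCovDeriv_apply (covM : CovariantDerivative I E (fun x : M ↦ TangentSpace I x))
    (covV : CovariantDerivative I F V) {σ : Π x : M, V x} {x : M}
    (hσ : MDiffAt (fun y ↦ TotalSpace.mk' (E →L[ℝ] F)
      (E := fun y ↦ TangentSpace I y →L[ℝ] V y) y (covV σ y)) x)
    {Y : Π x : M, TangentSpace I x} (hY : MDiffAt (T% Y) x) (u : TangentSpace I x) :
    secondCovDeriv covM covV σ x u (Y x) =
      covV (fun y ↦ covV σ y (Y y)) x u - covV σ x (covM Y x u) :=
  homCov_apply covM covV hσ hY u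

theorem secondCovDeriv_eq_zero_of_eventually_eq_zero
    (covM : CovariantDerivative I E (fun x : M ↦ TangentSpace I x))
    (covV : CovariantDerivative I F V) {σ : Π x : M, V x} {x : M} (hσ : ∀ᶠ y in 𝓝 x, σ y = 0) :
    secondCovDeriv covM covV σ x = 0 :=
  covariantDerivative_eq_zero_of_eventually_eq_zero (covM.hom covV) <|
    hσ.eventually_nhds.mono fun _ ↦ covariantDerivative_eq_zero_of_eventually_eq_zero covV

variable
  {F' : Type*} [NormedAddCommGroup F'] [NormedSpace ℝ F'] [FiniteDimensional ℝ F']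
  {W : M → Type*} [TopologicalSpace (TotalSpace F' W)]
  [∀ x, AddCommGroup (W x)] [∀ x, Module ℝ (W x)] [∀ x, TopologicalSpace (W x)]
  [∀ x, IsTopologicalAddGroup (W x)] [∀ x, ContinuousSMul ℝ (W x)]
  [FiberBundle F' W] [VectorBundle ℝ F' W] [ContMDiffVectorBundle 1 F' W I]

theorem covariantDerivative_clm_apply (covV : CovariantDerivative I F V)
    (covW : CovariantDerivative I F' W) {A : Π x : M, V x →L[ℝ] W x} {x : M}
    (hA : MDiffAt
      (fun y ↦ TotalSpace.mk' (F →L[ℝ] F') (E := fun y ↦ V y →L[ℝ] W y) y (A y)) x)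
    {σ : Π x : M, V x} (hσ : MDiffAt (T% σ) x) (u : TangentSpace I x) :
    covW (fun y ↦ A y (σ y)) x u = covV.hom covW A x u (σ x) + A x (covV σ x u) :=
  sub_eq_iff_eq_add.1 (homCov_apply covV covW hA hσ u).symm

theorem secondCovDeriv_clm_apply
    (covM : CovariantDerivative I E (fun x : M ↦ TangentSpace I x))
    (covV : CovariantDerivative I F V) (covW : CovariantDerivative I F' W)
    {A : Π x : M, V x →L[ℝ] W x} {σ : Π x : M, V x} {x : M}
    (hA : ∀ᶠ y in 𝓝 x, MDiffAt
      (fun y ↦ TotalSpace.mk' (F →L[ℝ] F') (E := fun y ↦ V y →L[ℝ] W y) y (A y)) y)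
    (hσ : ∀ᶠ y in 𝓝 x, MDiffAt (T% σ) y)
    (hDA : MDiffAt (fun y ↦ TotalSpace.mk' (E →L[ℝ] F →L[ℝ] F')
      (E := fun y ↦ TangentSpace I y →L[ℝ] V y →L[ℝ] W y) y (covV.hom covW A y)) x)
    (hDσ : MDiffAt (fun y ↦ TotalSpace.mk' (E →L[ℝ] F)
      (E := fun y ↦ TangentSpace I y →L[ℝ] V y) y (covV σ y)) x)
    (hDAσ : MDiffAt (fun y ↦ TotalSpace.mk' (E →L[ℝ] F')
      (E := fun y ↦ TangentSpace I y →L[ℝ] W y) y (covW (fun z ↦ A z (σ z)) y)) x)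
    (u w : TangentSpace I x) :
    secondCovDeriv covM covW (fun y ↦ A y (σ y)) x u w =
      secondCovDeriv covM (covV.hom covW) A x u w (σ x) + covV.hom covW A x u (covV σ x w) +
        covV.hom covW A x w (covV σ x u) + A x (secondCovDeriv covM covV σ x u w) := by
  have hA' := hA.self_of_nhds
  have hσ' := hσ.self_of_nhds
  let Y : Π y : M, TangentSpace I y := FiberBundle.extend E w
  have hY : MDiffAt (T% Y) x := FiberBundle.mdifferentiableAt_extend I E w
  have hYx : Y x = w := FiberBundle.extend_apply_self E w
  have hDAY := hDA.clm_bundle_apply hY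
  have hDσY := hDσ.clm_bundle_apply hY
  have hDAYσ := hDAY.clm_bundle_apply hσ'
  have hADσY := hA'.clm_bundle_apply hDσY
  have first_order : ∀ᶠ y in 𝓝 x, covW (fun z ↦ A z (σ z)) y (Y y) =
      covV.hom covW A y (Y y) (σ y) + A y (covV σ y (Y y)) := by
    filter_upwards [hA, hσ] with y hAy hσy using covariantDerivative_clm_apply covV covW hAy hσy _
  have second_order : covW (fun y ↦ covW (fun z ↦ A z (σ z)) y (Y y)) x u =
      covW (fun y ↦ covV.hom covW A y (Y y) (σ y)) x u +
        covW (fun y ↦ A y (covV σ y (Y y))) x u := by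
    rw [covW.isCovariantDerivativeOnUniv.congr_of_eventuallyEq (hDAσ.clm_bundle_apply hY)
      (mdifferentiableAt_add_section hDAYσ hADσY) Filter.univ_mem first_order]
    exact congr($(covW.isCovariantDerivativeOnUniv.add hDAYσ hADσY) u)
  rw [← hYx, secondCovDeriv_apply covM covW hDAσ hY, secondCovDeriv_apply covM covV hDσ hY,
    secondCovDeriv_apply covM (covV.hom covW) hDA hY, second_order,
    covariantDerivative_clm_apply covV covW hDAY hσ',
    covariantDerivative_clm_apply covV covW hA' hDσY,
    covariantDerivative_clm_apply covV covW hA' hσ', map_sub, sub_apply]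
  abel

end Leibniz

section KernelSections

theorem apply_eq_zero_of_inner_apply_self_nonpos {V : Type*} [NormedAddCommGroup V]
    [InnerProductSpace ℝ V] {T : V →ₗ[ℝ] V} (hT_symm : T.IsSymmetric)
    (hT_nonneg : ∀ v, 0 ≤ inner ℝ (T v) v) {v : V} (hv : inner ℝ (T v) v ≤ 0) : T v = 0 := by
  let B : LinearMap.BilinForm ℝ V := (innerₗ V).comp T
  have hB_symm : LinearMap.IsSymm B := ⟨fun v w ↦ (hT_symm v w).trans (real_inner_comm _ _)⟩
  have hBv : B v = 0 :=
    (B.apply_apply_same_eq_zero_iff hT_nonneg hB_symm).1 (hv.antisymm (hT_nonneg v))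
  exact inner_self_eq_zero.1 congr($hBv (T v))

theorem comp_eq_zero_of_sum_inner_nonpos {V W : Type*} [NormedAddCommGroup V]
    [InnerProductSpace ℝ V] [AddCommGroup W] [Module ℝ W] {T : V →ₗ[ℝ] V} (hT_symm : T.IsSymmetric)
    (hT_nonneg : ∀ v, 0 ≤ inner ℝ (T v) v) {L : W →ₗ[ℝ] V} {ι : Type*} [Fintype ι]
    (b : Module.Basis ι ℝ W) (h : ∑ i, inner ℝ (T (L (b i))) (L (b i)) ≤ 0) : T ∘ₗ L = 0 := by
  refine b.ext fun i ↦ apply_eq_zero_of_inner_apply_self_nonpos hT_symm hT_nonneg ?_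
  exact (Finset.single_le_sum (fun j _ ↦ hT_nonneg (L (b j))) (Finset.mem_univ i)).trans h

variable
  {E : Type*} [NormedAddCommGroup E] [NormedSpace ℝ E]
  {H : Type*} [TopologicalSpace H] {I : ModelWithCorners ℝ E H}
  {M : Type*} [TopologicalSpace M] [ChartedSpace H M]
  {F : Type*} [NormedAddCommGroup F] [NormedSpace ℝ F] [FiniteDimensional ℝ F]
  {V : M → Type*} [TopologicalSpace (TotalSpace F V)]
  [∀ x, NormedAddCommGroup (V x)] [∀ x, InnerProductSpace ℝ (V x)]
  [FiberBundle F V] [VectorBundle ℝ F V] [IsContMDiffRiemannianBundle I 1 F V]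

theorem inner_covariantDerivative_eq_neg_of_orthogonal [FiniteDimensional ℝ E] [IsManifold I 2 M]
    [ContMDiffVectorBundle 1 F V I] {nabla : CovariantDerivative I F V}
    (h_metric : nabla.IsMetricCompatible) {σ τ : Π x : M, V x} {x : M}
    (hσ : MDiffAt (T% σ) x) (hτ : MDiffAt (T% τ) x) (h : ∀ᶠ y in 𝓝 x, inner ℝ (σ y) (τ y) = 0)
    (u : TangentSpace I x) :
    inner ℝ (nabla σ x u) (τ x) = -inner ℝ (σ x) (nabla τ x u) := by
  have product_rule := h_metric.mvfderiv_inner_eq (FiberBundle.extend E u) hσ hτ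
  have derivative_zero : mvfderiv I (fun y ↦ inner ℝ (σ y) (τ y)) x = 0 := by
    have h0 : mvfderiv I (fun _ : M ↦ (0 : ℝ)) x = 0 := mvfderiv_const 0
    rw [← h0]
    exact Filter.EventuallyEq.mfderiv_eq h
  simp only [derivative_zero, FiberBundle.extend_apply_self, zero_apply] at product_rule
  linarith

variable [ContMDiffVectorBundle 1 F V I] [FiniteDimensional ℝ E] [IsManifold I 2 M]
  {nabla : CovariantDerivative I F V}
  {T : Π x : M, V x →L[ℝ] V x} {σ : Π x : M, V x} {x : M}

theorem inner_hom_apply_of_eventually_mem_ker (h_metric : nabla.IsMetricCompatible)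
    (hT_symm : ∀ x, (T x).toLinearMap.IsSymmetric)
    (hT : MDiffAt
      (fun y ↦ TotalSpace.mk' (F →L[ℝ] F) (E := fun y ↦ V y →L[ℝ] V y) y (T y)) x)
    (hσ : MDiffAt (T% σ) x) (hTσ : ∀ᶠ y in 𝓝 x, T y (σ y) = 0) (u : TangentSpace I x) (v : V x) :
    inner ℝ (nabla.hom nabla T x u v) (σ x) = -inner ℝ (T x v) (nabla σ x u) := by
  let τ : Π y : M, V y := FiberBundle.extend F v
  have hτ : MDiffAt (T% τ) x := FiberBundle.mdifferentiableAt_extend I F v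
  have hτx : τ x = v := FiberBundle.extend_apply_self F v
  have leibniz := covariantDerivative_clm_apply nabla nabla hT hτ u
  have orthogonal : ∀ᶠ y in 𝓝 x, inner ℝ (T y (τ y)) (σ y) = 0 := by
    filter_upwards [hTσ] with y hy
    exact (hT_symm y _ _).trans (by simp [hy])
  have tangential : inner ℝ (T x (nabla τ x u)) (σ x) = 0 :=
    (hT_symm x _ _).trans (by simp [hTσ.self_of_nhds])
  have := inner_covariantDerivative_eq_neg_of_orthogonal h_metric (hT.clm_bundle_apply hτ) hσ
    orthogonal u
  rw [leibniz, inner_add_left, tangential, add_zero, hτx] at this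
  exact this

theorem inner_secondCovDeriv_of_eventually_mem_ker
    (nablaM : CovariantDerivative I E (fun x : M ↦ TangentSpace I x))
    (h_metric : nabla.IsMetricCompatible) (hT_symm : ∀ x, (T x).toLinearMap.IsSymmetric)
    (hT : ∀ᶠ y in 𝓝 x, MDiffAt
      (fun y ↦ TotalSpace.mk' (F →L[ℝ] F) (E := fun y ↦ V y →L[ℝ] V y) y (T y)) y)
    (hσ : ∀ᶠ y in 𝓝 x, MDiffAt (T% σ) y)
    (hDT : MDiffAt (fun y ↦ TotalSpace.mk' (E →L[ℝ] F →L[ℝ] F)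
      (E := fun y ↦ TangentSpace I y →L[ℝ] V y →L[ℝ] V y) y (nabla.hom nabla T y)) x)
    (hDσ : MDiffAt (fun y ↦ TotalSpace.mk' (E →L[ℝ] F)
      (E := fun y ↦ TangentSpace I y →L[ℝ] V y) y (nabla σ y)) x)
    (hTσ : ∀ᶠ y in 𝓝 x, T y (σ y) = 0) (u w : TangentSpace I x) :
    inner ℝ (secondCovDeriv nablaM (nabla.hom nabla) T x u w (σ x)) (σ x) =
      2 * inner ℝ (T x (nabla σ x u)) (nabla σ x w) := by
  have hDTσ : ∀ᶠ y in 𝓝 x, nabla (fun z ↦ T z (σ z)) y = 0 :=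
    hTσ.eventually_nhds.mono fun _ ↦ covariantDerivative_eq_zero_of_eventually_eq_zero nabla
  have leibniz := secondCovDeriv_clm_apply nablaM nabla nabla hT hσ hDT hDσ
    (mdifferentiableAt_section_of_eventually_eq_zero hDTσ) u w
  rw [secondCovDeriv_eq_zero_of_eventually_eq_zero nablaM nabla hTσ] at leibniz
  have paired := congr(inner ℝ $leibniz (σ x))
  have hom_apply := inner_hom_apply_of_eventually_mem_ker h_metric hT_symm hT.self_of_nhds
    hσ.self_of_nhds hTσ
  have tangential (v : V x) : inner ℝ (T x v) (σ x) = 0 :=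
    (hT_symm x _ _).trans (by simp [hTσ.self_of_nhds])
  have symm : inner ℝ (T x (nabla σ x w)) (nabla σ x u) =
      inner ℝ (T x (nabla σ x u)) (nabla σ x w) :=
    (hT_symm x _ _).trans (real_inner_comm _ _)
  simp only [inner_add_left, hom_apply, tangential, symm, zero_apply, inner_zero_left] at paired
  linarith

theorem inner_XLaplacian_of_eventually_mem_ker
    [RiemannianBundle (fun x : M ↦ TangentSpace I x)]
    (nablaM : CovariantDerivative I E (fun x : M ↦ TangentSpace I x))
    (h_metric : nabla.IsMetricCompatible) (X : Π x : M, TangentSpace I x)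
    (hT_symm : ∀ x, (T x).toLinearMap.IsSymmetric)
    (hT : ∀ᶠ y in 𝓝 x, MDiffAt
      (fun y ↦ TotalSpace.mk' (F →L[ℝ] F) (E := fun y ↦ V y →L[ℝ] V y) y (T y)) y)
    (hσ : ∀ᶠ y in 𝓝 x, MDiffAt (T% σ) y)
    (hDT : MDiffAt (fun y ↦ TotalSpace.mk' (E →L[ℝ] F →L[ℝ] F)
      (E := fun y ↦ TangentSpace I y →L[ℝ] V y →L[ℝ] V y) y (nabla.hom nabla T y)) x)
    (hDσ : MDiffAt (fun y ↦ TotalSpace.mk' (E →L[ℝ] F)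
      (E := fun y ↦ TangentSpace I y →L[ℝ] V y) y (nabla σ y)) x)
    (hTσ : ∀ᶠ y in 𝓝 x, T y (σ y) = 0)
    {ι : Type*} [Fintype ι] (b : OrthonormalBasis ι ℝ (TangentSpace I x)) :
    inner ℝ (XLaplacian nablaM (nabla.hom nabla) X T x (σ x)) (σ x) =
      2 * ∑ i, inner ℝ (T x (nabla σ x (b i))) (nabla σ x (b i)) := by
  have first_order : inner ℝ (nabla.hom nabla T x (X x) (σ x)) (σ x) = 0 := by
    rw [inner_hom_apply_of_eventually_mem_ker h_metric hT_symm hT.self_of_nhds hσ.self_of_nhds hTσ,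
      hTσ.self_of_nhds, inner_zero_left, neg_zero]
  rw [XLaplacian, connLaplacian_eq_sum nablaM _ _ _ b, sub_apply, inner_sub_left, first_order,
    sub_zero, sum_apply, sum_inner, Finset.mul_sum]
  exact Finset.sum_congr rfl fun i _ ↦
    inner_secondCovDeriv_of_eventually_mem_ker nablaM h_metric hT_symm hT hσ hDT hDσ hTσ _ _

end KernelSections

section ParallelKernel

variable
  {E : Type*} [NormedAddCommGroup E] [NormedSpace ℝ E] [FiniteDimensional ℝ E]
  {H : Type*} [TopologicalSpace H] {I : ModelWithCorners ℝ E H}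
  {M : Type*} [TopologicalSpace M] [T2Space M] [ChartedSpace H M] [IsManifold I ∞ M]
  {F : Type*} [NormedAddCommGroup F] [NormedSpace ℝ F] [FiniteDimensional ℝ F]
  {V : M → Type*} [TopologicalSpace (TotalSpace F V)]
  [∀ x, NormedAddCommGroup (V x)] [∀ x, InnerProductSpace ℝ (V x)]
  [FiberBundle F V] [VectorBundle ℝ F V] [ContMDiffVectorBundle ∞ F V I]
  [IsContMDiffRiemannianBundle I 1 F V]

theorem isParallelSubspace_ker [RiemannianBundle (fun x : M ↦ TangentSpace I x)] {k : ℕ∞}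
    (hk : k ≠ 0) (nablaM : CovariantDerivative I E (fun x : M ↦ TangentSpace I x))
    {nabla : CovariantDerivative I F V} [nabla.ContMDiffCovariantDerivative k]
    (h_metric : nabla.IsMetricCompatible) (X : Π x : M, TangentSpace I x)
    {T : Π x : M, V x →L[ℝ] V x}
    (hT : CMDiff (k + 1)
      (fun x ↦ TotalSpace.mk' (F →L[ℝ] F) (E := fun x ↦ V x →L[ℝ] V x) x (T x)))
    (hT_symm : ∀ x, (T x).toLinearMap.IsSymmetric)
    (hT_nonneg : ∀ (x : M) (v : V x), 0 ≤ inner ℝ (T x v) v)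
    (hT_laplacian : ∀ (x : M) (v : V x), T x v = 0 →
      inner ℝ (XLaplacian nablaM (nabla.hom nabla) X T x v) v ≤ 0) :
    IsParallelSubspace nabla (fun x ↦ LinearMap.ker (T x).toLinearMap) := by
  intro U σ hU hσ hTσ x hx u
  have hUx : U ∈ 𝓝 x := hU.mem_nhds hx
  have hσ : CMDiff[U] (k + 1) (T% σ) := hσ.of_le (by exact_mod_cast le_top)
  have hDT : CMDiff k (fun y ↦ TotalSpace.mk' (E →L[ℝ] F →L[ℝ] F)
      (E := fun y ↦ TangentSpace I y →L[ℝ] V y →L[ℝ] V y) y (nabla.hom nabla T y)) :=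
    contMDiffOn_univ.1 (contMDiffOn_covariantDerivative _ isOpen_univ hT.contMDiffOn)
  have hDσ := (contMDiffOn_covariantDerivative nabla hU hσ).contMDiffAt hUx
  let b := stdOrthonormalBasis ℝ (TangentSpace I x)
  have laplacian := inner_XLaplacian_of_eventually_mem_ker nablaM h_metric X hT_symm
    (.of_forall fun y ↦ (hT y).mdifferentiableAt (by simp))
    (by filter_upwards [hUx] with y hy using
      (hσ.contMDiffAt (hU.mem_nhds hy)).mdifferentiableAt (by simp))
    ((hDT x).mdifferentiableAt (by exact_mod_cast hk))
    (hDσ.mdifferentiableAt (by exact_mod_cast hk))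
    (Filter.mem_of_superset hUx hTσ) b
  have sum_nonpos : ∑ i, inner ℝ (T x (nabla σ x (b i))) (nabla σ x (b i)) ≤ 0 := by
    linarith [hT_laplacian x (σ x) (hTσ x hx)]
  have comp_eq_zero : (T x).toLinearMap ∘ₗ (nabla σ x).toLinearMap = 0 :=
    comp_eq_zero_of_sum_inner_nonpos (hT_symm x) (hT_nonneg x) b.toBasis
      (by simpa using! sum_nonpos)
  exact LinearMap.congr_fun comp_eq_zero u

end ParallelKernel

section ConstantRankFamily

theorem exists_comp_comp_eq_self {K V W : Type*} [DivisionRing K] [AddCommGroup V] [Module K V]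
    [AddCommGroup W] [Module K W] (A : V →ₗ[K] W) : ∃ C : W →ₗ[K] V, A ∘ₗ C ∘ₗ A = A := by
  obtain ⟨g, hg⟩ := A.rangeRestrict.exists_rightInverse_of_surjective A.range_rangeRestrict
  obtain ⟨C, hC⟩ := LinearMap.exists_extend g
  refine ⟨C, LinearMap.ext fun v ↦ ?_⟩
  have hCv : C (A v) = g (A.rangeRestrict v) := LinearMap.congr_fun hC (A.rangeRestrict v)
  simpa [hCv] using congr((($hg) (A.rangeRestrict v) : W))

theorem map_ker_eq_ker_of_comp_comp_eq_self {K V W : Type*} [DivisionRing K] [AddCommGroup V]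
    [Module K V] [FiniteDimensional K V] [AddCommGroup W] [Module K W] {A A' : V →ₗ[K] W}
    {C : W →ₗ[K] V} (hC : A ∘ₗ C ∘ₗ A = A)
    (hA' : Module.finrank K (LinearMap.ker A') = Module.finrank K (LinearMap.ker A))
    (B : V ≃ₗ[K] V) (hB : ∀ v, B v = C (A' v) + (v - C (A v))) :
    (LinearMap.ker A').map B.toLinearMap = LinearMap.ker A := by
  refine Submodule.eq_of_le_of_finrank_eq ?_ ((B.finrank_map_eq _).trans hA')
  rintro _ ⟨v, hv, rfl⟩
  have hCv : A (C (A v)) = A v := LinearMap.congr_fun hC v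
  have hA'v : A' v = 0 := hv
  simp [hB, hA'v, hCv]

theorem linearIndependent_and_span_comp_of_map_eq {K V W ι : Type*} [Ring K] [AddCommGroup V]
    [Module K V] [AddCommGroup W] [Module K W] {S : Submodule K V} {S' : Submodule K W}
    (e : V ≃ₗ[K] W) (he : S.map e.toLinearMap = S') {v : ι → V}
    (hv : LinearIndependent K v ∧ Submodule.span K (Set.range v) = S) :
    LinearIndependent K (e ∘ v) ∧ Submodule.span K (Set.range (e ∘ v)) = S' :=
  ⟨hv.1.map' e.toLinearMap e.ker, by
    rw [← he, ← hv.2, Submodule.map_span, ← Set.range_comp, LinearEquiv.coe_coe]⟩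

variable
  {E : Type*} [NormedAddCommGroup E] [NormedSpace ℝ E]
  {H : Type*} [TopologicalSpace H] {I : ModelWithCorners ℝ E H}
  {M : Type*} [TopologicalSpace M] [ChartedSpace H M]
  {F : Type*} [NormedAddCommGroup F] [NormedSpace ℝ F] [FiniteDimensional ℝ F]
  {F' : Type*} [NormedAddCommGroup F'] [NormedSpace ℝ F'] [FiniteDimensional ℝ F']
  {n : ℕ∞ω} {O : Set M} {A : M → F →L[ℝ] F'} {r : ℕ} {x : M}

theorem exists_contMDiffOn_equiv_map_ker (hO : IsOpen O) (hA : CMDiff[O] n A)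
    (hr : ∀ y ∈ O, Module.finrank ℝ (LinearMap.ker (A y).toLinearMap) = r) (hx : x ∈ O) :
    ∃ U ⊆ O, IsOpen U ∧ x ∈ U ∧ ∃ Ψ : M → F ≃L[ℝ] F,
      CMDiff[U] n (fun y ↦ (Ψ y : F →L[ℝ] F)) ∧
      ∀ y ∈ U, (LinearMap.ker (A x).toLinearMap).map (Ψ y).toLinearEquiv.toLinearMap =
        LinearMap.ker (A y).toLinearMap := by
  have : CompleteSpace F := FiniteDimensional.complete ℝ F
  obtain ⟨C₀, hC₀⟩ := exists_comp_comp_eq_self (A x).toLinearMap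
  let C : F' →L[ℝ] F := C₀.toContinuousLinearMap
  let B : M → F →L[ℝ] F := fun y ↦ C ∘L A y + (1 - C ∘L A x)
  have hB : CMDiff[O] n B := (contMDiffOn_const.clm_comp hA).add contMDiffOn_const
  let U : Set M := O ∩ B ⁻¹' {L | IsUnit L}
  have hU : IsOpen U := hB.continuousOn.isOpen_inter_preimage hO Units.isOpen
  have hBU : ∀ y ∈ U, ∃ b : (F →L[ℝ] F)ˣ, b = B y := fun y hy ↦ hy.2
  choose! b hb using hBU
  refine ⟨U, Set.inter_subset_left, hU, ⟨hx, by simp [B]⟩,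
    fun y ↦ (ContinuousLinearEquiv.unitsEquiv ℝ F (b y)).symm, fun y hy ↦ ?_, fun y hy ↦ ?_⟩
  · have hinv : ContDiffAt ℝ n Ring.inverse (B y) := hb y hy ▸ contDiffAt_ringInverse ℝ (b y)
    refine (hinv.contMDiffAt.comp y (hB.contMDiffAt (hO.mem_nhds hy.1))).congr_of_eventuallyEq ?_
      |>.contMDiffWithinAt
    filter_upwards [hU.mem_nhds hy] with z hz
    rw [Function.comp_apply, ← hb z hz, Ring.inverse_unit]
    rfl
  · have hker := map_ker_eq_ker_of_comp_comp_eq_self hC₀ ((hr y hy.1).trans (hr x hx).symm)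
      (ContinuousLinearEquiv.unitsEquiv ℝ F (b y)).toLinearEquiv
      fun v ↦ DFunLike.congr_fun (hb y hy) v
    rw [← hker, ← Submodule.map_comp]
    simp

theorem exists_contMDiffOn_frame_ker (hO : IsOpen O) (hA : CMDiff[O] n A)
    (hr : ∀ y ∈ O, Module.finrank ℝ (LinearMap.ker (A y).toLinearMap) = r) (hx : x ∈ O) :
    ∃ U ⊆ O, IsOpen U ∧ x ∈ U ∧ ∃ σ : Fin r → M → F, (∀ i, CMDiff[U] n (σ i)) ∧
      ∀ y ∈ U, LinearIndependent ℝ (fun i ↦ σ i y) ∧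
        Submodule.span ℝ (Set.range fun i ↦ σ i y) = LinearMap.ker (A y).toLinearMap := by
  obtain ⟨U, hUO, hU, hxU, Ψ, hΨ, hker⟩ := exists_contMDiffOn_equiv_map_ker hO hA hr hx
  let b := Module.finBasisOfFinrankEq ℝ (LinearMap.ker (A x).toLinearMap) (hr x hx)
  have hb : Submodule.span ℝ (Set.range fun i ↦ (b i : F)) = LinearMap.ker (A x).toLinearMap := by
    rw [show (Set.range fun i ↦ (b i : F)) = Submodule.subtype _ '' Set.range b from
      Set.range_comp _ _, ← Submodule.map_span, b.span_eq, Submodule.map_subtype_top]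
  refine ⟨U, hUO, hU, hxU, fun i y ↦ Ψ y (b i), fun i ↦ hΨ.clm_apply contMDiffOn_const,
    fun y hy ↦ ?_⟩
  exact linearIndependent_and_span_comp_of_map_eq (Ψ y).toLinearEquiv (hker y hy)
    ⟨b.linearIndependent.map' (Submodule.subtype _) (Submodule.ker_subtype _), hb⟩

end ConstantRankFamily

section KernelSubbundle

variable
  {E : Type*} [NormedAddCommGroup E] [NormedSpace ℝ E]
  {H : Type*} [TopologicalSpace H] {I : ModelWithCorners ℝ E H}
  {M : Type*} [TopologicalSpace M] [ChartedSpace H M]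
  {F : Type*} [NormedAddCommGroup F] [NormedSpace ℝ F]
  {V : M → Type*} [TopologicalSpace (TotalSpace F V)]
  [∀ x, AddCommGroup (V x)] [∀ x, Module ℝ (V x)] [∀ x, TopologicalSpace (V x)]
  [FiberBundle F V] [VectorBundle ℝ F V]
  {F' : Type*} [NormedAddCommGroup F'] [NormedSpace ℝ F']
  {W : M → Type*} [TopologicalSpace (TotalSpace F' W)]
  [∀ x, AddCommGroup (W x)] [∀ x, Module ℝ (W x)] [∀ x, TopologicalSpace (W x)]
  [FiberBundle F' W] [VectorBundle ℝ F' W]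

theorem map_symm_ker_inCoordinates {x y : M}
    (hV : y ∈ (trivializationAt F V x).baseSet) (hW : y ∈ (trivializationAt F' W x).baseSet)
    (L : V y →L[ℝ] W y) :
    (LinearMap.ker (ContinuousLinearMap.inCoordinates F V F' W x y x y L).toLinearMap).map
      ((trivializationAt F V x).continuousLinearEquivAt ℝ y hV).symm.toLinearEquiv.toLinearMap =
        LinearMap.ker L.toLinearMap := by
  rw [ContinuousLinearMap.inCoordinates_eq hV hW]
  let e := ((trivializationAt F V x).continuousLinearEquivAt ℝ y hV).toLinearEquiv
  let e' := ((trivializationAt F' W x).continuousLinearEquivAt ℝ y hW).toLinearEquiv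
  change (LinearMap.ker (e'.toLinearMap ∘ₗ L.toLinearMap ∘ₗ e.symm.toLinearMap)).map
    e.symm.toLinearMap = _
  rw [LinearEquiv.ker_comp, LinearMap.ker_comp]
  exact Submodule.map_comap_eq_of_surjective e.symm.surjective _

variable [FiniteDimensional ℝ F] [FiniteDimensional ℝ F']
  [∀ x, IsTopologicalAddGroup (W x)] [∀ x, ContinuousSMul ℝ (W x)]
  [ContMDiffVectorBundle ∞ F V I] [ContMDiffVectorBundle ∞ F' W I]

theorem isSmoothSubbundle_ker {T : Π x : M, V x →L[ℝ] W x}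
    (hT : CMDiff ∞ (fun x ↦ TotalSpace.mk' (F →L[ℝ] F') (E := fun x ↦ V x →L[ℝ] W x) x (T x)))
    {k : ℕ} (hk : ∀ x, Module.finrank ℝ (LinearMap.range (T x).toLinearMap) = k) :
    IsSmoothSubbundle I F (fun x ↦ LinearMap.ker (T x).toLinearMap) := by
  refine ⟨Module.finrank ℝ F - k, fun x ↦ ?_⟩
  let e := trivializationAt F V x
  let e' := trivializationAt F' W x
  let O := e.baseSet ∩ e'.baseSet
  have hO : IsOpen O := e.open_baseSet.inter e'.open_baseSet
  have hxO : x ∈ O := ⟨FiberBundle.mem_baseSet_trivializationAt' x,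
    FiberBundle.mem_baseSet_trivializationAt' x⟩
  let A : M → F →L[ℝ] F' := fun y ↦ ContinuousLinearMap.inCoordinates F V F' W x y x y (T y)
  have hA : CMDiff[O] ∞ A :=
    ((trivializationAt (F →L[ℝ] F') (fun y ↦ V y →L[ℝ] W y) x).contMDiffOn_section_iff
      (IB := I) (n := ∞) (s := T) hO (by simp [O, e, e'])).1 hT.contMDiffOn
  have hker : ∀ y (hy : y ∈ O), (LinearMap.ker (A y).toLinearMap).map
      (e.continuousLinearEquivAt ℝ y hy.1).symm.toLinearEquiv.toLinearMap =
        LinearMap.ker (T y).toLinearMap :=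
    fun y hy ↦ map_symm_ker_inCoordinates hy.1 hy.2 (T y)
  have hr : ∀ y ∈ O,
      Module.finrank ℝ (LinearMap.ker (A y).toLinearMap) = Module.finrank ℝ F - k := by
    intro y hy
    have : FiniteDimensional ℝ (V y) := VectorBundle.finiteDimensional ℝ F V y
    have rank_nullity := (T y).toLinearMap.finrank_range_add_finrank_ker
    rw [hk, VectorBundle.finrank_eq ℝ F V, ← hker y hy, LinearEquiv.finrank_map_eq] at rank_nullity
    omega
  obtain ⟨U, hUO, hU, hxU, σ, hσ, hσU⟩ := exists_contMDiffOn_frame_ker hO hA hr hxO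
  refine ⟨U, hU, hxU, fun i y ↦ e.symm y (σ i y), fun i ↦ ?_, fun y hy ↦ ?_⟩
  · rw [e.contMDiffOn_section_iff hU fun y hy ↦ (hUO hy).1]
    refine (hσ i).congr fun y hy ↦ ?_
    rw [e.apply_mk_symm (hUO hy).1]
  · exact linearIndependent_and_span_comp_of_map_eq
      (e.continuousLinearEquivAt ℝ y (hUO hy).1).symm.toLinearEquiv (hker y (hUO hy)) (hσU y hy)

end KernelSubbundle

theorem mainTheorem11_general
    {E : Type*} [NormedAddCommGroup E] [NormedSpace ℝ E] [FiniteDimensional ℝ E]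
    {H : Type*} [TopologicalSpace H] {I : ModelWithCorners ℝ E H}
    {M : Type*} [TopologicalSpace M] [T2Space M] [ChartedSpace H M] [IsManifold I ∞ M]
    [RiemannianBundle (fun x : M ↦ TangentSpace I x)]
    (nablaM : CovariantDerivative I E (fun x : M ↦ TangentSpace I x))
    {F : Type*} [NormedAddCommGroup F] [NormedSpace ℝ F] [FiniteDimensional ℝ F]
    {V : M → Type*} [TopologicalSpace (TotalSpace F V)]
    [∀ x, NormedAddCommGroup (V x)] [∀ x, InnerProductSpace ℝ (V x)]
    [FiberBundle F V] [VectorBundle ℝ F V] [ContMDiffVectorBundle ∞ F V I]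
    [IsContMDiffRiemannianBundle I 1 F V]
    (nabla : CovariantDerivative I F V) [nabla.ContMDiffCovariantDerivative ∞]
    (h_metric : nabla.IsMetricCompatible)
    (X : Π x : M, TangentSpace I x)
    (T : Π x : M, V x →L[ℝ] V x)
    (hT_smooth : ContMDiff I (I.prod 𝓘(ℝ, F →L[ℝ] F)) ∞
      (fun x ↦ TotalSpace.mk' (F →L[ℝ] F) (E := fun x ↦ V x →L[ℝ] V x) x (T x)))
    (hT_rank : ∃ k : ℕ, ∀ x, Module.finrank ℝ (LinearMap.range (T x).toLinearMap) = k)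
    (hT_symm : ∀ (x : M) (v w : V x), inner ℝ (T x v) w = inner ℝ v (T x w))
    (hT_nonneg : ∀ (x : M) (v : V x), 0 ≤ inner ℝ (T x v) v)
    (hT_laplacian : ∀ (x : M) (v : V x), T x v = 0 →
      inner ℝ (XLaplacian nablaM (nabla.hom nabla) X T x v) v ≤ 0) :
    IsSmoothSubbundle I F (fun x ↦ LinearMap.ker (T x).toLinearMap) ∧
      IsParallelSubspace nabla (fun x ↦ LinearMap.ker (T x).toLinearMap) := by
  obtain ⟨k, hk⟩ := hT_rank
  exact ⟨isSmoothSubbundle_ker hT_smooth hk, isParallelSubspace_ker (k := ⊤) (by simp) nablaM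
    h_metric X hT_smooth hT_symm hT_nonneg hT_laplacian⟩

theorem mainTheorem11
    {E : Type*} [NormedAddCommGroup E] [NormedSpace ℝ E] [FiniteDimensional ℝ E]
    {H : Type*} [TopologicalSpace H] {I : ModelWithCorners ℝ E H} [I.Boundaryless]
    {M : Type*} [TopologicalSpace M] [T2Space M] [ChartedSpace H M] [IsManifold I ∞ M]
    [RiemannianBundle (fun x : M ↦ TangentSpace I x)]
    [IsContMDiffRiemannianBundle I ∞ E (fun x : M ↦ TangentSpace I x)]
    (nablaM : CovariantDerivative I E (fun x : M ↦ TangentSpace I x))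
    (hM : IsLeviCivita nablaM)
    {F : Type*} [NormedAddCommGroup F] [NormedSpace ℝ F] [FiniteDimensional ℝ F]
    {V : M → Type*} [TopologicalSpace (TotalSpace F V)]
    [∀ x, NormedAddCommGroup (V x)] [∀ x, InnerProductSpace ℝ (V x)]
    [FiberBundle F V] [VectorBundle ℝ F V] [ContMDiffVectorBundle ∞ F V I]
    [IsContMDiffRiemannianBundle I ∞ F V]
    (nabla : CovariantDerivative I F V) [nabla.ContMDiffCovariantDerivative ∞]
    (h_metric : nabla.IsMetricCompatible)
    (X : Π x : M, TangentSpace I x)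
    (T : Π x : M, V x →L[ℝ] V x)
    (hT_smooth : ContMDiff I (I.prod 𝓘(ℝ, F →L[ℝ] F)) ∞
      (fun x ↦ TotalSpace.mk' (F →L[ℝ] F) (E := fun x ↦ V x →L[ℝ] V x) x (T x)))
    (hT_rank : ∃ k : ℕ, ∀ x, Module.finrank ℝ (LinearMap.range (T x).toLinearMap) = k)
    (hT_symm : ∀ (x : M) (v w : V x), inner ℝ (T x v) w = inner ℝ v (T x w))
    (hT_nonneg : ∀ (x : M) (v : V x), 0 ≤ inner ℝ (T x v) v)
    (hT_laplacian : ∀ (x : M) (v : V x), T x v = 0 →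
      inner ℝ (XLaplacian nablaM (nabla.hom nabla) X T x v) v ≤ 0) :
    IsSmoothSubbundle I F (fun x ↦ LinearMap.ker (T x).toLinearMap) ∧
      IsParallelSubspace nabla (fun x ↦ LinearMap.ker (T x).toLinearMap) :=
  mainTheorem11_general nablaM nabla h_metric X T hT_smooth hT_rank hT_symm hT_nonneg hT_laplacian
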